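/- **Setting.** There are $K\ge 2$ agents. All observations are random elements of a measurable space $\mathcal Z$ defined on one probability space. Agent $j$ holds null samples $Y^{(j)}_1,\dots,Y^{(j)}_{n_j}$, of which the first $k_j$ are training samples and the other $\ell_j=n_j-k_j$ are calibration samples, and test points $X^{(j)}_1,\dots,X^{(j)}_{m_j}$; the sizes may vary with $j$. Put $Z^{(j)}=(Z^{(j)}_1,\dots,Z^{(j)}_{n_j+m_j})=(Y^{(j)}_1,\dots,Y^{(j)}_{n_j},X^{(j)}_1,\dots,X^{(j)}_{m_j})$. There are laws $P_0^{(1)},\dots,P_0^{(K)}$ on $\mathcal Z$, and the test indices of agent $j$ are partitioned into true nulls $\mathcal H_0^{(j)}$ and novelties $\mathcal H_1^{(j)}$: $Y^{(j)}_i$ and $X^{(j)}_t$, $t\in\mathcal H_0^{(j)}$, have law $P_0^{(j)}$, while for $t\in\mathcal H_1^{(j)}$ the law of $X^{(j)}_t$ differs from every $P_0^{(a)}$, $1\le a\le K$. Let $U^{(j)}=(Y^{(j)}_1,\dots,Y^{(j)}_{n_j},X^{(j)}_t,\,t\in\mathcal H_0^{(j)})$ and $V^{(j)}=(X^{(j)}_t,\,t\in\mathcal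 H_1^{(j)})$. Assume: 1. for each $j$, the sequence $U^{(j)}$ is exchangeable conditionally on $V^{(j)}$; 2. the samples $Z^{(1)},\dots,Z^{(K)}$ are mutually independent (nothing is assumed on the dependence among the novelties of one agent). Let $H^{(j)}$ be the unsplit dataset of agent $j$: the training sequence $(Z^{(j)}_1,\dots,Z^{(j)}_{k_j})$ together with the mixture $(Z^{(j)}_{k_j+1},\dots,Z^{(j)}_{n_j+m_j})$. Agent $j$ has a score function $g^{(j)}(z;H^{(j)})\in\mathbb R$, jointly measurable in $(z,H^{(j)})$ and invariant under every reordering of the mixture in $H^{(j)}$. Agents evaluate their points by one of the composite max-scores $$S^{(j)}(z)=\max_{1\le a\le K} g^{(a)}(z;H^{(a)})\qquad\text{(unquantized)},$$ $$S^{(j)}(z)=\max\Big\{g^{(j)}(z;H^{(j)}),\ \max_{a\ne j} f^{(a)}\big(z;\,q^{(a)}(\mathcal A^{(a)}(H^{(a)}))\big)\Big\}\qquad\text{(quantized)},$$ where the learning algorithms $\mathcal A^{(a)}$ (with values in a measurable parameter space), the quantizers $q^{(a)}$ (with values in another measurable space) and the surrogate score functions $f^{(a)}$ are deterministic and measurable.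 Assume, for the composite score in use, that almost surely, for each $j$, the numbers $S^{(j)}(Z^{(j)}_i)$, $k_j<i\le n_j+m_j$, are pairwise distinct. The empirical $p$-values are $$p^{(j)}_t=\frac1{\ell_j+1}\Big(1+\sum_{i=k_j+1}^{n_j}\mathbf 1\{S^{(j)}(Z_i^{(j)})\ge S^{(j)}(X^{(j)}_t)\}\Big),\qquad 1\le t\le m_j .$$ **Theorem (Global FDR Control: Conservative Model Exchange).** Let $\alpha\ge0$. For either composite score, suppose every agent $j$ applies the Benjamini–Hochberg procedure at level $\alpha/K$ to $p^{(j)}_1,\dots,p^{(j)}_{m_j}$: with $\hat r_j$ the largest $r\in\{0,\dots,m_j\}$ such that at least $r$ of these $p$-values are at most $\frac{\alpha}{K}\frac{r}{m_j}$, it rejects nothing if $\hat r_j=0$, and otherwise rejects the $t$ with $p^{(j)}_t\le\frac{\alpha}{K}\frac{\hat r_j}{m_j}$. Let $R_j$ be the number of its rejections and $V_j$ the number of its rejections in $\mathcal H_0^{(j)}$. Then $$\mathrm{FDR}_{\mathrm{global}}=\mathbb E\left[\frac{\sum_{j=1}^K V_j}{\big(\sum_{j=1}^K R_j\big)\vee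 1}\right]\le\alpha .$$ -/

import Mathlib

open MeasureTheory ProbabilityTheory

namespace ModelExchange

/-! ### Index sets and local samples

An agent with `k` training nulls, `ℓ` calibration nulls (so `n = k + ℓ` null training samples in
total) and `m` test points holds the sample `Z = (Y_1, …, Y_k, Y_{k+1}, …, Y_n, X_1, …, X_m)`. -/

/-- Positions in the mixture `Z_{k+1}, …, Z_{n+m}`: calibration nulls, then test points. -/
abbrev MixIdx (ℓ m : ℕ) : Type := Fin ℓ ⊕ Fin m

/-- Positions in the full sample `Z_1, …, Z_{n+m}`. -/
abbrev ObsIdx (k ℓ m : ℕ) : Type := Fin k ⊕ MixIdx ℓ m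

/-- Position of the `t`-th test point in the full sample. -/
def testIdx {k ℓ m : ℕ} (t : Fin m) : ObsIdx k ℓ m := Sum.inr (Sum.inr t)

/-- The positions that hold nulls: all of `Y_1, …, Y_n`, and `X_t` for `t ∈ H₀`. -/
def IsNullIdx {k ℓ m : ℕ} (H₀ : Finset (Fin m)) : ObsIdx k ℓ m → Prop
  | Sum.inl _ => True
  | Sum.inr (Sum.inl _) => True
  | Sum.inr (Sum.inr t) => t ∈ H₀

section Sample

variable {Ω 𝒵 : Type*} [MeasurableSpace Ω] [MeasurableSpace 𝒵] {k ℓ m : ℕ}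

/-- The sequence `U = (Y_1, …, Y_n, X_t, t ∈ H₀)` of all true nulls of an agent. -/
def nullSeq (H₀ : Finset (Fin m)) (Z : ObsIdx k ℓ m → Ω → 𝒵) :
    {i : ObsIdx k ℓ m // IsNullIdx H₀ i} → Ω → 𝒵 :=
  fun i => Z i.1

/-- The sequence `V = (X_t, t ∉ H₀)` of the novelties of an agent. -/
def noveltySeq (H₀ : Finset (Fin m)) (Z : ObsIdx k ℓ m → Ω → 𝒵) :
    {t : Fin m // t ∉ H₀} → Ω → 𝒵 :=
  fun t => Z (testIdx t.1)

/-- `U` is exchangeable conditionally on `V`: for every permutation `π` of the indices of `U`,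
`U` and `U_π` have the same conditional distribution given the `σ`-algebra generated by `V`. -/
def CondExchangeable (μ : Measure Ω) {ι κ : Type*} (U : ι → Ω → 𝒵) (V : κ → Ω → 𝒵) : Prop :=
  ∀ (π : Equiv.Perm ι) (A : Set (ι → 𝒵)), MeasurableSet A →
    μ⟦(fun ω i => U (π i) ω) ⁻¹' A | MeasurableSpace.comap (fun ω t => V t ω) inferInstance⟧
      =ᵐ[μ]
    μ⟦(fun ω i => U i ω) ⁻¹' A | MeasurableSpace.comap (fun ω t => V t ω) inferInstance⟧

/-- `H₀` is the set of true nulls among the test points of agent `j`, for the composite null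
`{P₀ a}`: nulls of agent `j` have law `P₀ j`, and novelties have a law different from every `P₀ a`.
The null training samples have law `P₀ j`. -/
def IsNullLabelling {K : ℕ} (μ : Measure Ω) (P₀ : Fin K → Measure 𝒵) (j : Fin K)
    (H₀ : Finset (Fin m)) (Z : ObsIdx k ℓ m → Ω → 𝒵) : Prop :=
  (∀ i, IsNullIdx H₀ i → μ.map (Z i) = P₀ j) ∧
    ∀ t, t ∉ H₀ → ∀ a, μ.map (Z (testIdx t)) ≠ P₀ a

end Sample

/-! ### Local datasets and composite scores -/

/-- A positive-unlabelled dataset: the training nulls as a sequence, and the mixture of calibration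
nulls and test points, listed in some order. -/
abbrev PUData (𝒵 : Type*) (k ℓ m : ℕ) : Type _ := (Fin k → 𝒵) × (MixIdx ℓ m → 𝒵)

/-- The unsplit dataset of an agent, made of all of its observations. -/
def puData {𝒵 : Type*} {k ℓ m : ℕ} (z : ObsIdx k ℓ m → 𝒵) : PUData 𝒵 k ℓ m :=
  (fun i => z (Sum.inl i), fun i => z (Sum.inr i))

/-- The score function `g(· ; H)` does not depend on the internal order of the mixture in `H`. -/
def MixtureInvariant {𝒵 : Type*} {k ℓ m : ℕ} (g : 𝒵 → PUData 𝒵 k ℓ m → ℝ) : Prop :=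
  ∀ (z : 𝒵) (tr : Fin k → 𝒵) (mix : MixIdx ℓ m → 𝒵) (σ : Equiv.Perm (MixIdx ℓ m)),
    g z (tr, mix ∘ σ) = g z (tr, mix)

section Scores

variable {K : ℕ} {𝒵 : Type*} {k ℓ m : Fin K → ℕ}

/-- The composite max-score `max_a g_a(z ; H_a)`, without quantization. Agent `j` is only used to
see that there is at least one agent. -/
noncomputable def compositeScore (g : ∀ a, 𝒵 → PUData 𝒵 (k a) (ℓ a) (m a) → ℝ) (j : Fin K)
    (H : ∀ a, PUData 𝒵 (k a) (ℓ a) (m a)) (z : 𝒵) : ℝ :=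
  Finset.univ.sup' ⟨j, Finset.mem_univ j⟩ fun a => g a z (H a)

/-- The quantized composite max-score `max {g_j(z ; H_j), max_{a ≠ j} F_a(z)}` of agent `j`, where
`F_a(z) = f_a(z ; q_a(𝒜_a(H_a)))` is the surrogate model received from agent `a`. -/
noncomputable def quantizedCompositeScore {Θ Θ' : Fin K → Type*}
    (g : ∀ a, 𝒵 → PUData 𝒵 (k a) (ℓ a) (m a) → ℝ)
    (𝒜 : ∀ a, PUData 𝒵 (k a) (ℓ a) (m a) → Θ a) (q : ∀ a, Θ a → Θ' a)
    (f : ∀ a, 𝒵 → Θ' a → ℝ) (j : Fin K)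
    (H : ∀ a, PUData 𝒵 (k a) (ℓ a) (m a)) (z : 𝒵) : ℝ :=
  Finset.univ.sup' ⟨j, Finset.mem_univ j⟩ fun a =>
    if a = j then g j z (H j) else f a z (q a (𝒜 a (H a)))

/-- The scores of the calibration and test points of agent `j` when the composite score functions
`S` are computed from the unsplit datasets of all agents. -/
def evalScores (S : Fin K → (∀ a, PUData 𝒵 (k a) (ℓ a) (m a)) → 𝒵 → ℝ)
    (z : ∀ a, ObsIdx (k a) (ℓ a) (m a) → 𝒵) (j : Fin K) : MixIdx (ℓ j) (m j) → ℝ :=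
  fun i => S j (fun a => puData (z a)) (z j (Sum.inr i))

end Scores

/-! ### Empirical p-values, the Benjamini–Hochberg procedure, the false discovery rate -/

/-- The empirical p-value of test point `t`:
`(1 + #{calibration points i : S_i ≥ S_t}) / (ℓ + 1)`. -/
noncomputable def empiricalPValue {ℓ m : ℕ} (s : MixIdx ℓ m → ℝ) (t : Fin m) : ℝ :=
  (1 + ∑ i : Fin ℓ, if s (Sum.inl i) ≥ s (Sum.inr t) then (1 : ℝ) else 0) / ((ℓ : ℝ) + 1)

/-- The Benjamini–Hochberg step-up index at level `β`: the largest `r ≤ m` such that at least `r`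
of the p-values are at most `β r / m`, that is, `r = 0` or `p_(r) ≤ β r / m`. -/
noncomputable def bhIndex {m : ℕ} (β : ℝ) (p : Fin m → ℝ) : ℕ :=
  Nat.findGreatest
    (fun r => r ≤ (Finset.univ.filter fun t : Fin m => p t ≤ β * (r : ℝ) / (m : ℝ)).card) m

/-- The rejection set of the Benjamini–Hochberg procedure at level `β`. -/
noncomputable def bhRejections {m : ℕ} (β : ℝ) (p : Fin m → ℝ) : Finset (Fin m) :=
  Finset.univ.filter fun t => 0 < bhIndex β p ∧ p t ≤ β * (bhIndex β p : ℝ) / (m : ℝ)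

/-- The global false discovery proportion `(∑ V_j) / ((∑ R_j) ∨ 1)` of rejection sets `R j`. -/
noncomputable def globalFDP {K : ℕ} {m : Fin K → ℕ} (H₀ R : ∀ j, Finset (Fin (m j))) : ℝ :=
  ((∑ j, (R j ∩ H₀ j).card : ℕ) : ℝ) / (max (∑ j, (R j).card) 1 : ℕ)

/-- The global false discovery proportion when each agent applies the Benjamini–Hochberg procedure
at level `α / K` to the empirical p-values of its own test points, for the scores `S`. -/
noncomputable def localBHGlobalFDP {K : ℕ} {𝒵 : Type*} {k ℓ m : Fin K → ℕ} (α : ℝ)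
    (H₀ : ∀ j, Finset (Fin (m j)))
    (S : Fin K → (∀ a, PUData 𝒵 (k a) (ℓ a) (m a)) → 𝒵 → ℝ)
    (z : ∀ a, ObsIdx (k a) (ℓ a) (m a) → 𝒵) : ℝ :=
  globalFDP H₀ fun j => bhRejections (α / (K : ℝ)) (empiricalPValue (evalScores S z j))

/-- Almost surely, for every agent, the scores of its calibration and test points have no ties. -/
def NoTies {Ω : Type*} [MeasurableSpace Ω] (μ : Measure Ω) {K : ℕ} {𝒵 : Type*}
    {k ℓ m : Fin K → ℕ} (S : Fin K → (∀ a, PUData 𝒵 (k a) (ℓ a) (m a)) → 𝒵 → ℝ)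
    (Z : ∀ a, ObsIdx (k a) (ℓ a) (m a) → Ω → 𝒵) : Prop :=
  ∀ᵐ ω ∂μ, ∀ j, Function.Injective (evalScores S (fun a i => Z a i ω) j)

end ModelExchange

namespace ModelExchange

/-! ### Deterministic properties of the Benjamini–Hochberg procedure -/

/-! Enlarging no denominator below its own agent's count, the global proportion is at most the sum
of the local ones (`globalFDP_le_sum`), and each local one is a sum of shares `1{t ∈ R} / |R|` over
true nulls `t`. It suffices that a null's share has mean at most `β / m` with `β = α / K`: summing
over at most `m` nulls and `K` agents gives `α`.

Exchanging a null `t` with a calibration point preserves the joint law of all samples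
(`measurePreserving_permMixture`). The composite score ignores the order of the agent's own mixture,
so the exchange merely permutes that agent's scores. Hence the mean share equals its mean after
averaging over the `ℓ + 1` exchanges, the trivial one included.

That average is bounded pointwise (`sum_rejShare_poolSwap_le`). Placing a higher pool score at `t`
lowers every p-value and enlarges the rejection set. Among the exchanges that reject `t`, the one
with the lowest score thus has the smallest rejection set `R`; its p-value at `t`, times `ℓ + 1`,
counts at least all these exchanges and is at most `(ℓ + 1) β |R| / m`. -/

theorem bhIndex_anti {m : ℕ} {β : ℝ} {p p' : Fin m → ℝ} (h : ∀ t, p t ≤ p' t) :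
    bhIndex β p' ≤ bhIndex β p := by
  unfold bhIndex
  refine Nat.findGreatest_mono_left (fun r hr => hr.trans (Finset.card_le_card ?_)) m
  intro t ht
  simp only [Finset.mem_filter, Finset.mem_univ, true_and] at ht ⊢
  exact (h t).trans ht

theorem bhIndex_le_card {m : ℕ} (β : ℝ) (p : Fin m → ℝ) :
    bhIndex β p ≤ (bhRejections β p).card := by
  rcases Nat.eq_zero_or_pos (bhIndex β p) with h0 | hpos
  · omega
  -- The index `0` always meets the counting condition, so the greatest index meets it too.
  · have h := Nat.findGreatest_spec (m := 0)
      (P := fun r => r ≤ (Finset.univ.filter fun t : Fin m => p t ≤ β * (r : ℝ) / (m : ℝ)).card)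
      (n := m) (Nat.zero_le _) (Nat.zero_le _)
    change bhIndex β p ≤ (Finset.univ.filter fun t : Fin m =>
      p t ≤ β * (bhIndex β p : ℝ) / (m : ℝ)).card at h
    refine h.trans (Finset.card_le_card fun t ht => ?_)
    simp only [bhRejections, Finset.mem_filter, Finset.mem_univ, true_and] at ht ⊢
    exact ⟨hpos, ht⟩

/-- Smaller p-values raise the step-up index, and since `β ≥ 0` the threshold rises with it. -/
theorem bhRejections_anti {m : ℕ} {β : ℝ} (hβ : 0 ≤ β) {p p' : Fin m → ℝ} (h : ∀ t, p t ≤ p' t) :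
    bhRejections β p' ⊆ bhRejections β p := by
  intro t ht
  simp only [bhRejections, Finset.mem_filter, Finset.mem_univ, true_and] at ht ⊢
  have hi := bhIndex_anti (β := β) h
  refine ⟨ht.1.trans_le hi, (h t).trans (ht.2.trans ?_)⟩
  gcongr

/-- Self-consistency: the threshold is expressed through the number of rejections, the quantity that
cancels against the share. -/
theorem le_of_mem_bhRejections {m : ℕ} {β : ℝ} (hβ : 0 ≤ β) {p : Fin m → ℝ} {t : Fin m}
    (ht : t ∈ bhRejections β p) : p t ≤ β * ((bhRejections β p).card : ℝ) / (m : ℝ) := by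
  have h := (Finset.mem_filter.1 ht).2.2
  refine h.trans ?_
  have := bhIndex_le_card β p
  gcongr

/-- The contribution `1{t ∈ R} / |R|` of the test point `t` to the false discovery proportion, where
`R` is the rejection set computed from the scores `s`. -/
noncomputable def rejShare {ℓ m : ℕ} (β : ℝ) (t : Fin m) (s : MixIdx ℓ m → ℝ) : ℝ :=
  if t ∈ bhRejections β (empiricalPValue s) then
    ((bhRejections β (empiricalPValue s)).card : ℝ)⁻¹ else 0

theorem rejShare_nonneg {ℓ m : ℕ} (β : ℝ) (t : Fin m) (s : MixIdx ℓ m → ℝ) :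
    0 ≤ rejShare β t s := by
  unfold rejShare
  split_ifs <;> positivity

theorem rejShare_le_one {ℓ m : ℕ} (β : ℝ) (t : Fin m) (s : MixIdx ℓ m → ℝ) :
    rejShare β t s ≤ 1 := by
  unfold rejShare
  split_ifs
  · exact Nat.cast_inv_le_one _
  · exact zero_le_one

/-- The test point `t` (as `none`) and the calibration points of an agent. -/
def poolIdx {ℓ m : ℕ} (t : Fin m) (c : Option (Fin ℓ)) : MixIdx ℓ m :=
  c.elim (Sum.inr t) Sum.inl

/-- The exchange of test point `t` with a calibration point. -/
def poolSwap {ℓ m : ℕ} (t : Fin m) (c : Option (Fin ℓ)) : Equiv.Perm (MixIdx ℓ m) :=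
  Equiv.swap (Sum.inr t) (poolIdx t c)

/-- The exchange preserves the pool as a multiset; the calibration slots then hold all of it except
the point `c`, now at `t`. -/
theorem sum_calibration_poolSwap {ℓ m : ℕ} (s : MixIdx ℓ m → ℝ) (t : Fin m) (c : Option (Fin ℓ))
    (x : ℝ) :
    (∑ i : Fin ℓ, if (s ∘ poolSwap t c) (Sum.inl i) ≥ x then (1 : ℝ) else 0) =
      (∑ d : Option (Fin ℓ), if s (poolIdx t d) ≥ x then (1 : ℝ) else 0) -
        if s (poolIdx t c) ≥ x then 1 else 0 := by
  rw [Fintype.sum_option]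
  cases c with
  | none => simp [poolSwap, poolIdx]
  | some c =>
    have h : ∀ i : Fin ℓ, (if (s ∘ poolSwap t (some c)) (Sum.inl i) ≥ x then (1 : ℝ) else 0) =
        (if s (Sum.inl i) ≥ x then 1 else 0) + if i = c then
          ((if s (Sum.inr t) ≥ x then 1 else 0) - if s (Sum.inl c) ≥ x then 1 else 0) else 0 := by
      intro i
      by_cases hi : i = c
      · subst hi
        simp [poolSwap, poolIdx]
      · simp [poolSwap, poolIdx, hi, Equiv.swap_apply_of_ne_of_ne]
    simp_rw [h, Finset.sum_add_distrib]
    simp only [Finset.sum_ite_eq', Finset.mem_univ, if_true]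
    change _ = ((if s (Sum.inr t) ≥ x then (1 : ℝ) else 0) +
      ∑ i, if s (Sum.inl i) ≥ x then (1 : ℝ) else 0) - if s (Sum.inl c) ≥ x then (1 : ℝ) else 0
    ring

theorem poolSwap_apply_test {ℓ m : ℕ} (t : Fin m) (c : Option (Fin ℓ)) :
    poolSwap t c (Sum.inr t) = poolIdx t c := by
  simp [poolSwap]

theorem poolSwap_apply_of_ne {ℓ m : ℕ} {t u : Fin m} (h : u ≠ t) (c : Option (Fin ℓ)) :
    poolSwap t c (Sum.inr u) = Sum.inr u := by
  apply Equiv.swap_apply_of_ne_of_ne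
  · simpa using h
  · cases c <;> simp [poolIdx, h]

/-- The `1 +` in the p-value counts `c` itself, so the p-value at `t` is the normalized rank of `c`
in the pool. -/
theorem empiricalPValue_poolSwap_self {ℓ m : ℕ} (s : MixIdx ℓ m → ℝ) (t : Fin m)
    (c : Option (Fin ℓ)) :
    empiricalPValue (s ∘ poolSwap t c) t =
      (∑ d : Option (Fin ℓ), if s (poolIdx t d) ≥ s (poolIdx t c) then (1 : ℝ) else 0) /
        ((ℓ : ℝ) + 1) := by
  unfold empiricalPValue
  rw [sum_calibration_poolSwap, Function.comp_apply, poolSwap_apply_test]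
  simp

/-- Exchanging `t` with a pool point of higher score lowers all p-values. -/
theorem empiricalPValue_poolSwap_le {ℓ m : ℕ} (s : MixIdx ℓ m → ℝ) (t : Fin m)
    {c c' : Option (Fin ℓ)} (h : s (poolIdx t c') ≤ s (poolIdx t c)) (u : Fin m) :
    empiricalPValue (s ∘ poolSwap t c) u ≤ empiricalPValue (s ∘ poolSwap t c') u := by
  by_cases hu : u = t
  · subst hu
    rw [empiricalPValue_poolSwap_self, empiricalPValue_poolSwap_self]
    gcongr with d _
    split_ifs with h1 h2
    · exact le_rfl
    · exact absurd (h.trans h1) h2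
    · exact zero_le_one
    · exact le_rfl
  -- The score of `u` stays put; removing a higher score from the calibration set removes at least
  -- as much from the count.
  · unfold empiricalPValue
    rw [sum_calibration_poolSwap, sum_calibration_poolSwap, Function.comp_apply,
      Function.comp_apply, poolSwap_apply_of_ne hu, poolSwap_apply_of_ne hu]
    gcongr
    split_ifs with h1 h2
    · exact le_rfl
    · exact absurd (ge_trans h h1) h2
    · exact zero_le_one
    · exact le_rfl

/-- Averaged over the exchanges of `t` with the calibration points, the share of `t` is at most
`β / m`. -/
theorem sum_rejShare_poolSwap_le {ℓ m : ℕ} {β : ℝ} (hβ : 0 ≤ β) (s : MixIdx ℓ m → ℝ) (t : Fin m) :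
    ∑ c : Option (Fin ℓ), rejShare β t (s ∘ poolSwap t c) ≤ ((ℓ : ℝ) + 1) * (β / m) := by
  set R : Option (Fin ℓ) → Finset (Fin m) :=
    fun c => bhRejections β (empiricalPValue (s ∘ poolSwap t c)) with hR
  set A : Finset (Option (Fin ℓ)) := Finset.univ.filter fun c => t ∈ R c with hA
  have hsum : ∑ c : Option (Fin ℓ), rejShare β t (s ∘ poolSwap t c) =
      ∑ c ∈ A, ((R c).card : ℝ)⁻¹ := by
    rw [hA, Finset.sum_filter]
    rfl
  rw [hsum]
  rcases A.eq_empty_or_nonempty with h0 | hne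
  · rw [h0, Finset.sum_empty]
    positivity
  -- The lowest-scoring exchange that rejects `t` has the smallest rejection set, hence the largest
  -- share.
  · obtain ⟨c, hc, hmin⟩ := A.exists_min_image (fun c => s (poolIdx t c)) hne
    have htc : t ∈ R c := (Finset.mem_filter.1 hc).2
    have hRpos : (0 : ℝ) < (R c).card := by
      exact_mod_cast Finset.card_pos.2 ⟨t, htc⟩
    have hle : ∀ d ∈ A, ((R d).card : ℝ)⁻¹ ≤ ((R c).card : ℝ)⁻¹ := by
      intro d hd
      have := Finset.card_le_card
        (bhRejections_anti hβ (empiricalPValue_poolSwap_le s t (hmin d hd)))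
      exact inv_anti₀ hRpos (by exact_mod_cast this)
    have hcard : (A.card : ℝ) ≤
        ∑ d : Option (Fin ℓ), if s (poolIdx t d) ≥ s (poolIdx t c) then (1 : ℝ) else 0 := by
      rw [Finset.sum_boole]
      refine Nat.cast_le.2 (Finset.card_le_card fun d hd => ?_)
      simpa using hmin d hd
    have hp := le_of_mem_bhRejections hβ htc
    rw [empiricalPValue_poolSwap_self, div_le_iff₀ (by positivity)] at hp
    calc ∑ d ∈ A, ((R d).card : ℝ)⁻¹ ≤ A.card * ((R c).card : ℝ)⁻¹ := by
          simpa using Finset.sum_le_card_nsmul A _ _ hle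
      _ ≤ (β * ((R c).card : ℝ) / m * (ℓ + 1)) * ((R c).card : ℝ)⁻¹ := by
          gcongr
          exact hcard.trans hp
      _ = (ℓ + 1) * (β / m) := by
          field_simp

/-! ### From shares to the global false discovery proportion -/

theorem card_inter_div_card_eq_sum_rejShare {ℓ m : ℕ} (β : ℝ) (H : Finset (Fin m))
    (s : MixIdx ℓ m → ℝ) :
    ((bhRejections β (empiricalPValue s) ∩ H).card : ℝ) /
        (bhRejections β (empiricalPValue s)).card = ∑ t ∈ H, rejShare β t s := by
  unfold rejShare
  rw [← Finset.sum_filter, Finset.sum_const, nsmul_eq_mul, div_eq_mul_inv, Finset.inter_comm,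
    Finset.filter_mem_eq_inter]

theorem globalFDP_nonneg {K : ℕ} {m : Fin K → ℕ} (H₀ R : ∀ j, Finset (Fin (m j))) :
    0 ≤ globalFDP H₀ R := by
  unfold globalFDP
  positivity

theorem globalFDP_le_one {K : ℕ} {m : Fin K → ℕ} (H₀ R : ∀ j, Finset (Fin (m j))) :
    globalFDP H₀ R ≤ 1 := by
  unfold globalFDP
  refine div_le_one_of_le₀ ?_ (by positivity)
  refine Nat.cast_le.2 (le_max_of_le_left (Finset.sum_le_sum fun j _ => ?_))
  exact Finset.card_le_card Finset.inter_subset_left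

theorem globalFDP_le_sum {K : ℕ} {m : Fin K → ℕ} (H₀ R : ∀ j, Finset (Fin (m j))) :
    globalFDP H₀ R ≤ ∑ j, ((R j ∩ H₀ j).card : ℝ) / (R j).card := by
  unfold globalFDP
  rw [Nat.cast_sum, Finset.sum_div]
  refine Finset.sum_le_sum fun j _ => ?_
  rcases (R j).eq_empty_or_nonempty with h | h
  -- Without rejections both sides vanish, the right one as `0 / 0 = 0`.
  · simp [h]
  · have hpos : (0 : ℝ) < (R j).card := by exact_mod_cast Finset.card_pos.2 h
    have : (R j).card ≤ max (∑ j, (R j).card) 1 :=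
      le_max_of_le_left (Finset.single_le_sum (f := fun j => (R j).card)
        (fun _ _ => Nat.zero_le _) (Finset.mem_univ j))
    have h' : ((R j).card : ℝ) ≤ (max (∑ j, (R j).card) 1 : ℕ) := by exact_mod_cast this
    gcongr

theorem localBHGlobalFDP_le_sum {K : ℕ} {𝒵 : Type*} {k ℓ m : Fin K → ℕ} (α : ℝ)
    (H₀ : ∀ j, Finset (Fin (m j)))
    (S : Fin K → (∀ a, PUData 𝒵 (k a) (ℓ a) (m a)) → 𝒵 → ℝ)
    (z : ∀ a, ObsIdx (k a) (ℓ a) (m a) → 𝒵) :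
    localBHGlobalFDP α H₀ S z ≤ ∑ j, ∑ t ∈ H₀ j, rejShare (α / K) t (evalScores S z j) := by
  refine (globalFDP_le_sum _ _).trans_eq (Finset.sum_congr rfl fun j _ => ?_)
  exact card_inter_div_card_eq_sum_rejShare _ _ _

end ModelExchange
namespace ModelExchange

/-! ### Measurability -/

theorem measurable_empiricalPValue {ℓ m : ℕ} (t : Fin m) :
    Measurable fun s : MixIdx ℓ m → ℝ => empiricalPValue s t := by
  unfold empiricalPValue
  refine (measurable_const.add (Finset.measurable_sum _ fun i _ => ?_)).div_const _
  exact Measurable.ite (measurableSet_le (measurable_pi_apply _) (measurable_pi_apply _))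
    measurable_const measurable_const

theorem measurable_card_filter {X : Type*} [MeasurableSpace X] {ι : Type*} [Fintype ι]
    {P : X → ι → Prop} [∀ x, DecidablePred (P x)] (h : ∀ i, MeasurableSet {x | P x i}) :
    Measurable fun x => (Finset.univ.filter (P x)).card := by
  simp_rw [Finset.card_filter]
  exact Finset.measurable_sum _ fun i _ => Measurable.ite (h i) measurable_const measurable_const

theorem measurable_bhIndex {m : ℕ} (β : ℝ) :
    Measurable fun p : Fin m → ℝ => bhIndex β p := by
  unfold bhIndex
  refine measurable_findGreatest fun r _ => ?_
  exact measurableSet_le measurable_const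
    (measurable_card_filter fun t => measurableSet_le (measurable_pi_apply t) measurable_const)

theorem measurableSet_mem_bhRejections {m : ℕ} (β : ℝ) (t : Fin m) :
    MeasurableSet {p : Fin m → ℝ | t ∈ bhRejections β p} := by
  have hi := measurable_bhIndex (m := m) β
  simp only [bhRejections, Finset.mem_filter, Finset.mem_univ, true_and]
  refine (measurableSet_lt measurable_const hi).inter
    (measurableSet_le (measurable_pi_apply t) ?_)
  exact ((measurable_from_nat.comp hi).const_mul β).div_const _

/-- With the discrete σ-algebra on the target, every function of the rejection set becomes
measurable. -/
theorem measurable_bhRejections {m : ℕ} (β : ℝ) :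
    Measurable[_, ⊤] fun p : Fin m → ℝ => bhRejections β p := by
  let : MeasurableSpace (Finset (Fin m)) := ⊤
  refine measurable_to_countable' fun T => ?_
  have : (fun p : Fin m → ℝ => bhRejections β p) ⁻¹' {T} =
      ⋂ t, {p | t ∈ bhRejections β p ↔ t ∈ T} := by
    ext p
    simp [Finset.ext_iff]
  rw [this]
  exact MeasurableSet.iInter fun t =>
    (measurableSet_mem_bhRejections β t).iff (MeasurableSet.const _)

theorem measurable_comp_bhRejections {ℓ m : ℕ} (β : ℝ) {X : Type*} [MeasurableSpace X]
    {s : X → MixIdx ℓ m → ℝ} (hs : Measurable s) :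
    Measurable[_, ⊤] fun x => bhRejections β (empiricalPValue (s x)) :=
  (measurable_bhRejections β).comp
    ((measurable_pi_iff.2 fun t => measurable_empiricalPValue t).comp hs)

theorem measurable_rejShare {ℓ m : ℕ} (β : ℝ) (t : Fin m) :
    Measurable (rejShare (ℓ := ℓ) β t) := by
  let : MeasurableSpace (Finset (Fin m)) := ⊤
  exact (measurable_from_top (f := fun T : Finset (Fin m) =>
    if t ∈ T then (T.card : ℝ)⁻¹ else 0)).comp (measurable_comp_bhRejections β measurable_id)

theorem measurable_localBHGlobalFDP {K : ℕ} {𝒵 : Type*} [MeasurableSpace 𝒵] {k ℓ m : Fin K → ℕ}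
    (α : ℝ) (H₀ : ∀ j, Finset (Fin (m j)))
    {S : Fin K → (∀ a, PUData 𝒵 (k a) (ℓ a) (m a)) → 𝒵 → ℝ}
    (hS : ∀ j, Measurable fun z => evalScores S z j) :
    Measurable (localBHGlobalFDP α H₀ S) := by
  let (j : Fin K) : MeasurableSpace (Finset (Fin (m j))) := ⊤
  have h (j : Fin K) := measurable_comp_bhRejections (α / (K : ℝ)) (hS j)
  unfold localBHGlobalFDP globalFDP
  refine Measurable.div (measurable_from_nat.comp ?_) (measurable_from_nat.comp ?_)
  · exact Finset.measurable_sum _ fun j _ =>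
      (measurable_from_top (f := fun T : Finset (Fin (m j)) => (T ∩ H₀ j).card)).comp (h j)
  · exact (Finset.measurable_sum _ fun j _ =>
      (measurable_from_top (f := fun T : Finset (Fin (m j)) => T.card)).comp (h j)).max
      measurable_const

theorem measurable_puData {𝒵 : Type*} [MeasurableSpace 𝒵] {k ℓ m : ℕ} :
    Measurable (puData : (ObsIdx k ℓ m → 𝒵) → PUData 𝒵 k ℓ m) := by
  unfold puData
  fun_prop

section Scores

variable {K : ℕ} {𝒵 : Type*} [MeasurableSpace 𝒵] {k ℓ m : Fin K → ℕ}
  {g : ∀ a, 𝒵 → PUData 𝒵 (k a) (ℓ a) (m a) → ℝ}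

theorem measurable_sup'_apply {X ι : Type*} [MeasurableSpace X] {s : Finset ι} (hs : s.Nonempty)
    {F : ι → X → ℝ} (hF : ∀ a ∈ s, Measurable (F a)) :
    Measurable fun x => s.sup' hs fun a => F a x := by
  have h : (fun x => s.sup' hs fun a => F a x) = s.sup' hs F := by
    funext x
    exact (Finset.sup'_apply hs F x).symm
  rw [h]
  exact Finset.measurable_sup' hs hF

/-- Covers both models: `D` is the identity for a raw score and `q ∘ 𝒜` for a surrogate. -/
theorem measurable_score {Y : Type*} [MeasurableSpace Y] {h : 𝒵 → Y → ℝ}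
    (hh : Measurable (Function.uncurry h)) (j a : Fin K) (i : MixIdx (ℓ j) (m j))
    {D : PUData 𝒵 (k a) (ℓ a) (m a) → Y} (hD : Measurable D) :
    Measurable fun z : ∀ a, ObsIdx (k a) (ℓ a) (m a) → 𝒵 =>
      h (z j (Sum.inr i)) (D (puData (z a))) :=
  have hz : Measurable fun z : ∀ a, ObsIdx (k a) (ℓ a) (m a) → 𝒵 => z j (Sum.inr i) :=
    (measurable_pi_apply _).comp (measurable_pi_apply j)
  hh.comp (hz.prodMk (hD.comp (measurable_puData.comp (measurable_pi_apply a))))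

theorem measurable_evalScores_compositeScore (hg : ∀ a, Measurable (Function.uncurry (g a)))
    (j : Fin K) : Measurable fun z => evalScores (compositeScore g) z j := by
  refine measurable_pi_iff.2 fun i => ?_
  unfold evalScores compositeScore
  exact measurable_sup'_apply ⟨j, Finset.mem_univ j⟩
    (F := fun a (z : ∀ a, ObsIdx (k a) (ℓ a) (m a) → 𝒵) =>
      g a (z j (Sum.inr i)) (puData (z a)))
    fun a _ => measurable_score (hg a) j a i measurable_id

theorem measurable_evalScores_quantizedCompositeScore {Θ Θ' : Fin K → Type*}
    [∀ a, MeasurableSpace (Θ a)] [∀ a, MeasurableSpace (Θ' a)]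
    {𝒜 : ∀ a, PUData 𝒵 (k a) (ℓ a) (m a) → Θ a} {q : ∀ a, Θ a → Θ' a}
    {f : ∀ a, 𝒵 → Θ' a → ℝ} (hg : ∀ a, Measurable (Function.uncurry (g a)))
    (h𝒜 : ∀ a, Measurable (𝒜 a)) (hq : ∀ a, Measurable (q a))
    (hf : ∀ a, Measurable (Function.uncurry (f a))) (j : Fin K) :
    Measurable fun z => evalScores (quantizedCompositeScore g 𝒜 q f) z j := by
  refine measurable_pi_iff.2 fun i => ?_
  unfold evalScores quantizedCompositeScore
  exact measurable_sup'_apply ⟨j, Finset.mem_univ j⟩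
    (F := fun a (z : ∀ a, ObsIdx (k a) (ℓ a) (m a) → 𝒵) =>
      if a = j then g j (z j (Sum.inr i)) (puData (z j)) else
        f a (z j (Sum.inr i)) (q a (𝒜 a (puData (z a)))))
    fun a _ => by
      split_ifs
      · exact measurable_score (hg j) j j i measurable_id
      · exact measurable_score (hf a) j a i ((hq a).comp (h𝒜 a))

end Scores

/-- The score function of agent `j` does not depend on the order of the mixture of agent `j`. -/
def OwnMixtureInvariant {K : ℕ} {𝒵 : Type*} {k ℓ m : Fin K → ℕ}
    (S : Fin K → (∀ a, PUData 𝒵 (k a) (ℓ a) (m a)) → 𝒵 → ℝ) : Prop :=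
  ∀ (j : Fin K) (H H' : ∀ a, PUData 𝒵 (k a) (ℓ a) (m a)) (σ : Equiv.Perm (MixIdx (ℓ j) (m j))),
    (∀ a, a ≠ j → H' a = H a) → H' j = ((H j).1, (H j).2 ∘ σ) → S j H' = S j H

theorem ownMixtureInvariant_compositeScore {K : ℕ} {𝒵 : Type*} {k ℓ m : Fin K → ℕ}
    {g : ∀ a, 𝒵 → PUData 𝒵 (k a) (ℓ a) (m a) → ℝ} (hg : ∀ a, MixtureInvariant (g a)) :
    OwnMixtureInvariant (compositeScore g) := by
  intro j H H' σ hne hj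
  funext z
  refine Finset.sup'_congr _ rfl fun a _ => ?_
  by_cases ha : a = j
  · subst ha
    rw [hj, hg a]
  · rw [hne a ha]

/-- Agent `j` uses its own data only through `g j`; the surrogates depend on the other datasets,
which are held fixed. -/
theorem ownMixtureInvariant_quantizedCompositeScore {K : ℕ} {𝒵 : Type*} {k ℓ m : Fin K → ℕ}
    {Θ Θ' : Fin K → Type*} {g : ∀ a, 𝒵 → PUData 𝒵 (k a) (ℓ a) (m a) → ℝ}
    (hg : ∀ a, MixtureInvariant (g a)) (𝒜 : ∀ a, PUData 𝒵 (k a) (ℓ a) (m a) → Θ a)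
    (q : ∀ a, Θ a → Θ' a) (f : ∀ a, 𝒵 → Θ' a → ℝ) :
    OwnMixtureInvariant (quantizedCompositeScore g 𝒜 q f) := by
  intro j H H' σ hne hj
  funext z
  refine Finset.sup'_congr _ rfl fun a _ => ?_
  by_cases ha : a = j
  · rw [if_pos ha, if_pos ha, hj, hg j]
  · rw [if_neg ha, if_neg ha, hne a ha]

end ModelExchange
namespace ModelExchange

/-! ### Exchangeability -/

section Exchangeability

variable {Ω 𝒵 : Type*} [MeasurableSpace Ω] [MeasurableSpace 𝒵] {μ : Measure Ω}

/-- Conditional exchangeability of `U` given `V` makes the joint law of `(U, V)` invariant. -/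
theorem CondExchangeable.map_prodMk_eq [IsProbabilityMeasure μ] {ι κ : Type*} {U : ι → Ω → 𝒵}
    {V : κ → Ω → 𝒵} (h : CondExchangeable μ U V) (hU : ∀ i, Measurable (U i))
    (hV : ∀ t, Measurable (V t)) (π : Equiv.Perm ι) :
    μ.map (fun ω => ((fun i => U (π i) ω), fun t => V t ω)) =
      μ.map (fun ω => ((fun i => U i ω), fun t => V t ω)) := by
  have hV' : Measurable fun ω t => V t ω := measurable_pi_iff.2 hV
  have hU' : Measurable fun ω i => U i ω := measurable_pi_iff.2 hU
  have hUπ : Measurable fun ω i => U (π i) ω := measurable_pi_iff.2 fun i => hU _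
  have := Measure.isProbabilityMeasure_map (μ := μ) (hUπ.prodMk hV').aemeasurable
  have hm : MeasurableSpace.comap (fun ω t => V t ω) inferInstance ≤ ‹MeasurableSpace Ω› :=
    hV'.comap_le
  refine Measure.ext_prod fun {A} {B} hA hB => ?_
  rw [Measure.map_apply (hUπ.prodMk hV') (hA.prod hB), Measure.map_apply (hU'.prodMk hV')
    (hA.prod hB)]
  -- The probability of a rectangle is the conditional probability of one side integrated over the
  -- other.
  have key : ∀ W : Ω → ι → 𝒵, Measurable W →
      μ.real (W ⁻¹' A ∩ (fun ω t => V t ω) ⁻¹' B) =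
        ∫ ω in (fun ω t => V t ω) ⁻¹' B,
          (μ⟦W ⁻¹' A | MeasurableSpace.comap (fun ω t => V t ω) inferInstance⟧) ω ∂μ := by
    intro W hW
    rw [setIntegral_condExp hm ((integrable_const (1 : ℝ)).indicator (hW hA)) ⟨B, hB, rfl⟩,
      setIntegral_indicator (hW hA), setIntegral_const, Set.inter_comm, smul_eq_mul, mul_one]
  have h1 := (key _ hUπ).trans ((integral_congr_ae (ae_restrict_of_ae (h π A hA))).trans
    (key _ hU').symm)
  rw [Set.mk_preimage_prod, Set.mk_preimage_prod]
  exact (measureReal_eq_measureReal_iff).1 h1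

/-- The law of the sample of an agent is invariant under the permutations of its nulls. -/
theorem map_comp_perm_eq [IsProbabilityMeasure μ] {k ℓ m : ℕ} {H₀ : Finset (Fin m)}
    {Z : ObsIdx k ℓ m → Ω → 𝒵} (hZ : ∀ i, Measurable (Z i))
    (h : CondExchangeable μ (nullSeq H₀ Z) (noveltySeq H₀ Z))
    (e : Equiv.Perm (ObsIdx k ℓ m)) (he : ∀ i, ¬ IsNullIdx H₀ i → e i = i) :
    MeasurePreserving (fun z : ObsIdx k ℓ m → 𝒵 => z ∘ e) (μ.map fun ω i => Z i ω)
      (μ.map fun ω i => Z i ω) := by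
  classical
  have hZ' : Measurable fun ω i => Z i ω := measurable_pi_iff.2 hZ
  have hcomp : Measurable fun z : ObsIdx k ℓ m → 𝒵 => z ∘ e :=
    measurable_pi_iff.2 fun i => measurable_pi_apply _
  refine ⟨hcomp, ?_⟩
  have hiff : ∀ i, IsNullIdx H₀ (e i) ↔ IsNullIdx H₀ i := by
    intro i
    by_cases hi : IsNullIdx H₀ i
    · refine iff_of_true (by_contra fun hn => hn ?_) hi
      rw [e.injective (he _ hn)]
      exact hi
    · rw [he i hi]
  have hnov : ∀ i : ObsIdx k ℓ m, ¬ IsNullIdx H₀ i → ∃ t : {t : Fin m // t ∉ H₀}, i = testIdx t.1 := by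
    rintro (i | i | t) hi
    · exact absurd trivial hi
    · exact absurd trivial hi
    · exact ⟨⟨t, hi⟩, rfl⟩
  choose τ hτ using hnov
  -- `Φ` reassembles the sample from `(U, V)`, which transports the invariance of the joint law.
  let Φ : ({i : ObsIdx k ℓ m // IsNullIdx H₀ i} → 𝒵) × ({t : Fin m // t ∉ H₀} → 𝒵) →
      ObsIdx k ℓ m → 𝒵 := fun x i => if hi : IsNullIdx H₀ i then x.1 ⟨i, hi⟩ else x.2 (τ i hi)
  have hΦ : Measurable Φ := by
    refine measurable_pi_iff.2 fun i => ?_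
    by_cases hi : IsNullIdx H₀ i
    · simp only [Φ, hi, dif_pos]
      exact (measurable_pi_apply _).comp measurable_fst
    · simp only [Φ, hi, dif_neg, not_false_eq_true]
      exact (measurable_pi_apply _).comp measurable_snd
  have key := h.map_prodMk_eq (fun i => hZ _) (fun t => hZ _) (e.subtypePerm hiff)
  have key' := congrArg (Measure.map Φ) key
  have hU' : Measurable fun ω i => nullSeq H₀ Z i ω := measurable_pi_iff.2 fun i => hZ _
  have hUπ : Measurable fun ω i => nullSeq H₀ Z (e.subtypePerm hiff i) ω :=
    measurable_pi_iff.2 fun i => hZ _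
  have hV' : Measurable fun ω t => noveltySeq H₀ Z t ω := measurable_pi_iff.2 fun i => hZ _
  rw [Measure.map_map hΦ (hUπ.prodMk hV'), Measure.map_map hΦ (hU'.prodMk hV')] at key'
  rw [Measure.map_map hcomp hZ']
  convert key' using 2
  · funext ω i
    by_cases hi : IsNullIdx H₀ i
    · simp [Φ, hi, nullSeq]
    · simp only [Φ, hi, Function.comp_apply, dif_neg, not_false_eq_true, noveltySeq]
      rw [he i hi, ← hτ i hi]
  · funext ω i
    by_cases hi : IsNullIdx H₀ i
    · simp [Φ, hi, nullSeq]
    · simp only [Φ, hi, Function.comp_apply, dif_neg, not_false_eq_true, noveltySeq]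
      rw [← hτ i hi]

variable {K : ℕ} {k ℓ m : Fin K → ℕ}

/-- Reorders the mixture of agent `j` in the samples of all agents. -/
def permMixture (j : Fin K) (σ : Equiv.Perm (MixIdx (ℓ j) (m j)))
    (z : ∀ a, ObsIdx (k a) (ℓ a) (m a) → 𝒵) : ∀ a, ObsIdx (k a) (ℓ a) (m a) → 𝒵 :=
  fun a => z a ∘ (Function.update (β := fun a => Equiv.Perm (ObsIdx (k a) (ℓ a) (m a)))
    (fun a => Equiv.refl (ObsIdx (k a) (ℓ a) (m a))) j
    (Equiv.sumCongr (Equiv.refl _) σ) a)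

theorem measurePreserving_permMixture [IsProbabilityMeasure μ] {H₀ : ∀ j, Finset (Fin (m j))}
    {Z : ∀ j, ObsIdx (k j) (ℓ j) (m j) → Ω → 𝒵} (hZ : ∀ j i, Measurable (Z j i))
    (hexch : ∀ j, CondExchangeable μ (nullSeq (H₀ j) (Z j)) (noveltySeq (H₀ j) (Z j)))
    (hindep : iIndepFun (fun j ω i => Z j i ω) μ) (j : Fin K)
    (σ : Equiv.Perm (MixIdx (ℓ j) (m j))) (hσ : ∀ t, t ∉ H₀ j → σ (Sum.inr t) = Sum.inr t) :
    MeasurePreserving (permMixture (k := k) (𝒵 := 𝒵) j σ) (μ.map fun ω a i => Z a i ω)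
      (μ.map fun ω a i => Z a i ω) := by
  have hZ' : ∀ a, Measurable fun ω i => Z a i ω := fun a => measurable_pi_iff.2 (hZ a)
  have : ∀ a, IsProbabilityMeasure (μ.map fun ω i => Z a i ω) := fun a =>
    Measure.isProbabilityMeasure_map (hZ' a).aemeasurable
  -- By independence the joint law is a product, so invariance is checked agent by agent; agents
  -- other than `j` undergo the identity.
  rw [hindep.map_fun_eq_pi_map fun a => (hZ' a).aemeasurable]
  refine measurePreserving_pi _ _ (f := fun a z => z ∘ _) fun a =>
    map_comp_perm_eq (hZ a) (hexch a) _ fun i hi => ?_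
  by_cases ha : a = j
  · subst ha
    rw [Function.update_self]
    rcases i with i | i | t
    · rfl
    · exact absurd trivial hi
    · exact congrArg Sum.inr (hσ t hi)
  · rw [Function.update_of_ne ha]
    rfl

theorem OwnMixtureInvariant.evalScores_permMixture {𝒵 : Type*}
    {S : Fin K → (∀ a, PUData 𝒵 (k a) (ℓ a) (m a)) → 𝒵 → ℝ} (hS : OwnMixtureInvariant S)
    (j : Fin K) (σ : Equiv.Perm (MixIdx (ℓ j) (m j)))
    (z : ∀ a, ObsIdx (k a) (ℓ a) (m a) → 𝒵) :
    evalScores S (permMixture j σ z) j = evalScores S z j ∘ σ := by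
  have h : S j (fun a => puData (permMixture j σ z a)) = S j fun a => puData (z a) := by
    refine hS j _ _ σ (fun a ha => ?_) ?_
    · simp only [permMixture, Function.update_of_ne ha]
      rfl
    · simp only [permMixture, Function.update_self]
      rfl
  funext i
  refine (congrFun h _).trans (congrArg (S j fun a => puData (z a)) ?_)
  simp only [permMixture, Function.update_self]
  rfl

/-- The expected share of a null is at most `β / m`. -/
theorem integral_rejShare_le [IsProbabilityMeasure μ] {H₀ : ∀ j, Finset (Fin (m j))}
    {Z : ∀ j, ObsIdx (k j) (ℓ j) (m j) → Ω → 𝒵} (hZ : ∀ j i, Measurable (Z j i))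
    (hexch : ∀ j, CondExchangeable μ (nullSeq (H₀ j) (Z j)) (noveltySeq (H₀ j) (Z j)))
    (hindep : iIndepFun (fun j ω i => Z j i ω) μ)
    {S : Fin K → (∀ a, PUData 𝒵 (k a) (ℓ a) (m a)) → 𝒵 → ℝ} (hS : OwnMixtureInvariant S)
    (hS_meas : ∀ j, Measurable fun z => evalScores S z j) {β : ℝ} (hβ : 0 ≤ β) (j : Fin K)
    {t : Fin (m j)} (ht : t ∈ H₀ j) :
    Integrable (fun ω => rejShare β t (evalScores S (fun a i => Z a i ω) j)) μ ∧
      ∫ ω, rejShare β t (evalScores S (fun a i => Z a i ω) j) ∂μ ≤ β / m j := by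
  have hZ' : Measurable fun ω a i => Z a i ω :=
    measurable_pi_iff.2 fun a => measurable_pi_iff.2 (hZ a)
  set ν := μ.map fun ω a i => Z a i ω with hν
  have : IsProbabilityMeasure ν := Measure.isProbabilityMeasure_map hZ'.aemeasurable
  have hF : Measurable fun z : ∀ a, ObsIdx (k a) (ℓ a) (m a) → 𝒵 =>
    rejShare β t (evalScores S z j) := (measurable_rejShare β t).comp (hS_meas j)
  have hFint : Integrable (fun z : ∀ a, ObsIdx (k a) (ℓ a) (m a) → 𝒵 =>
      rejShare β t (evalScores S z j)) ν :=
    Integrable.of_bound hF.aestronglyMeasurable 1 (Filter.Eventually.of_forall fun z => by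
      rw [Real.norm_of_nonneg (rejShare_nonneg _ _ _)]
      exact rejShare_le_one _ _ _)
  have hpres : ∀ c : Option (Fin (ℓ j)),
      MeasurePreserving (permMixture (k := k) (𝒵 := 𝒵) j (poolSwap t c)) ν ν := fun c =>
    -- Since `t` is null, a novelty `u` differs from `t` and is fixed by the exchange.
    measurePreserving_permMixture hZ hexch hindep j _ fun u hu =>
      poolSwap_apply_of_ne (fun h => hu (by rwa [h])) c
  have hswap : ∀ c : Option (Fin (ℓ j)),
      Integrable (fun z => rejShare β t (evalScores S z j ∘ poolSwap t c)) ν ∧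
      ∫ z, rejShare β t (evalScores S z j ∘ poolSwap t c) ∂ν =
        ∫ z, rejShare β t (evalScores S z j) ∂ν := by
    intro c
    simp_rw [← hS.evalScores_permMixture]
    refine ⟨(hpres c).integrable_comp_of_integrable hFint, ?_⟩
    conv_rhs => rw [← (hpres c).map_eq]
    exact (integral_map (hpres c).measurable.aemeasurable hF.aestronglyMeasurable).symm
  refine ⟨hFint.comp_measurable hZ', ?_⟩
  have hpush : ∫ ω, rejShare β t (evalScores S (fun a i => Z a i ω) j) ∂μ =
      ∫ z, rejShare β t (evalScores S z j) ∂ν :=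
    (integral_map hZ'.aemeasurable hF.aestronglyMeasurable).symm
  rw [hpush]
  have hsum : ((ℓ j : ℝ) + 1) * ∫ z, rejShare β t (evalScores S z j) ∂ν ≤
      ((ℓ j : ℝ) + 1) * (β / m j) := by
    calc ((ℓ j : ℝ) + 1) * ∫ z, rejShare β t (evalScores S z j) ∂ν
        = ∑ c : Option (Fin (ℓ j)),
            ∫ z, rejShare β t (evalScores S z j ∘ poolSwap t c) ∂ν := by
          simp [(hswap _).2]
      _ = ∫ z, ∑ c : Option (Fin (ℓ j)),
            rejShare β t (evalScores S z j ∘ poolSwap t c) ∂ν :=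
          (integral_finsetSum _ fun c _ => (hswap c).1).symm
      _ ≤ ∫ _, ((ℓ j : ℝ) + 1) * (β / m j) ∂ν :=
          integral_mono (integrable_finsetSum _ fun c _ => (hswap c).1) (integrable_const _)
            fun z => sum_rejShare_poolSwap_le hβ _ t
      _ = ((ℓ j : ℝ) + 1) * (β / m j) := by simp
  exact le_of_mul_le_mul_left hsum (by positivity)

/-- Local Benjamini–Hochberg procedures at level `α / K` control the global false discovery rate,
for any scores that respect the exchangeability of the mixture of each agent. -/
theorem integral_localBHGlobalFDP_le [IsProbabilityMeasure μ] {H₀ : ∀ j, Finset (Fin (m j))}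
    {Z : ∀ j, ObsIdx (k j) (ℓ j) (m j) → Ω → 𝒵} (hZ : ∀ j i, Measurable (Z j i))
    (hexch : ∀ j, CondExchangeable μ (nullSeq (H₀ j) (Z j)) (noveltySeq (H₀ j) (Z j)))
    (hindep : iIndepFun (fun j ω i => Z j i ω) μ)
    {S : Fin K → (∀ a, PUData 𝒵 (k a) (ℓ a) (m a)) → 𝒵 → ℝ} (hS : OwnMixtureInvariant S)
    (hS_meas : ∀ j, Measurable fun z => evalScores S z j) {α : ℝ} (hα : 0 ≤ α) :
    Integrable (fun ω => localBHGlobalFDP α H₀ S fun a i => Z a i ω) μ ∧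
      ∫ ω, localBHGlobalFDP α H₀ S (fun a i => Z a i ω) ∂μ ≤ α := by
  have hZ' : Measurable fun ω a i => Z a i ω :=
    measurable_pi_iff.2 fun a => measurable_pi_iff.2 (hZ a)
  have hint : Integrable (fun ω => localBHGlobalFDP α H₀ S fun a i => Z a i ω) μ :=
    Integrable.of_bound
      ((measurable_localBHGlobalFDP α H₀ hS_meas).comp hZ').aestronglyMeasurable 1
      (Filter.Eventually.of_forall fun ω => by
        refine (Real.norm_of_nonneg (globalFDP_nonneg _ _)).trans_le ?_
        exact globalFDP_le_one _ _)
  refine ⟨hint, ?_⟩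
  have hβ : 0 ≤ α / (K : ℝ) := by positivity
  have hshare := fun j t ht => integral_rejShare_le hZ hexch hindep hS hS_meas hβ j (t := t) ht
  have hinner : ∀ j, Integrable (fun ω => ∑ t ∈ H₀ j,
      rejShare (α / K) t (evalScores S (fun a i => Z a i ω) j)) μ := fun j =>
    integrable_finsetSum _ fun t ht => (hshare j t ht).1
  calc ∫ ω, localBHGlobalFDP α H₀ S (fun a i => Z a i ω) ∂μ
      ≤ ∫ ω, ∑ j, ∑ t ∈ H₀ j, rejShare (α / K) t (evalScores S (fun a i => Z a i ω) j) ∂μ :=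
        integral_mono hint (integrable_finsetSum _ fun j _ => hinner j)
          fun ω => localBHGlobalFDP_le_sum _ _ _ _
    _ = ∑ j, ∑ t ∈ H₀ j, ∫ ω, rejShare (α / K) t (evalScores S (fun a i => Z a i ω) j) ∂μ := by
        rw [integral_finsetSum _ fun j _ => hinner j]
        exact Finset.sum_congr rfl fun j _ => integral_finsetSum _ fun t ht => (hshare j t ht).1
    _ ≤ ∑ j : Fin K, α / K := by
        refine Finset.sum_le_sum fun j _ => ?_
        refine (Finset.sum_le_sum fun t ht => (hshare j t ht).2).trans ?_
        rw [Finset.sum_const, nsmul_eq_mul, mul_div_assoc', mul_comm, mul_div_assoc]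
        -- There are at most `m j` nulls; if `m j = 0` the quotient is `0`.
        refine mul_le_of_le_one_right hβ (div_le_one_of_le₀ ?_ (Nat.cast_nonneg _))
        exact_mod_cast (Finset.card_le_univ (H₀ j)).trans_eq (Fintype.card_fin _)
    _ ≤ α := by
        rw [Finset.sum_const, Finset.card_univ, Fintype.card_fin, nsmul_eq_mul]
        rcases eq_or_ne (K : ℝ) 0 with h0 | h0
        · rwa [h0, zero_mul]
        · rw [mul_div_assoc', mul_div_cancel_left₀ _ h0]

end Exchangeability

end ModelExchange

theorem mainTheorem5 {Ω 𝒵 : Type*} [MeasurableSpace Ω] [MeasurableSpace 𝒵]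
    (μ : Measure Ω) [IsProbabilityMeasure μ]
    (K : ℕ) (hK : 2 ≤ K) (k ℓ m : Fin K → ℕ)
    (P₀ : Fin K → Measure 𝒵) (H₀ : ∀ j, Finset (Fin (m j)))
    (Z : ∀ j, ModelExchange.ObsIdx (k j) (ℓ j) (m j) → Ω → 𝒵)
    (hZ : ∀ j i, Measurable (Z j i))
    (hnull : ∀ j, ModelExchange.IsNullLabelling μ P₀ j (H₀ j) (Z j))
    (hexch : ∀ j, ModelExchange.CondExchangeable μ
      (ModelExchange.nullSeq (H₀ j) (Z j)) (ModelExchange.noveltySeq (H₀ j) (Z j)))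
    (hindep : iIndepFun (fun j ω i => Z j i ω) μ)
    (g : ∀ j, 𝒵 → ModelExchange.PUData 𝒵 (k j) (ℓ j) (m j) → ℝ)
    (hg_meas : ∀ j, Measurable (Function.uncurry (g j)))
    (hg_inv : ∀ j, ModelExchange.MixtureInvariant (g j))
    (α : ℝ) (hα : 0 ≤ α) :
    (ModelExchange.NoTies μ (ModelExchange.compositeScore g) Z →
      Integrable (fun ω => ModelExchange.localBHGlobalFDP α H₀
        (ModelExchange.compositeScore g) (fun a i => Z a i ω)) μ ∧
      ∫ ω, ModelExchange.localBHGlobalFDP α H₀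
        (ModelExchange.compositeScore g) (fun a i => Z a i ω) ∂μ ≤ α) ∧
    (∀ (Θ Θ' : Fin K → Type*) [∀ a, MeasurableSpace (Θ a)] [∀ a, MeasurableSpace (Θ' a)]
      (𝒜 : ∀ a, ModelExchange.PUData 𝒵 (k a) (ℓ a) (m a) → Θ a) (q : ∀ a, Θ a → Θ' a)
      (f : ∀ a, 𝒵 → Θ' a → ℝ),
      (∀ a, Measurable (𝒜 a)) → (∀ a, Measurable (q a)) →
      (∀ a, Measurable (Function.uncurry (f a))) →
      ModelExchange.NoTies μ (ModelExchange.quantizedCompositeScore g 𝒜 q f) Z →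
      Integrable (fun ω => ModelExchange.localBHGlobalFDP α H₀
        (ModelExchange.quantizedCompositeScore g 𝒜 q f) (fun a i => Z a i ω)) μ ∧
      ∫ ω, ModelExchange.localBHGlobalFDP α H₀
        (ModelExchange.quantizedCompositeScore g 𝒜 q f) (fun a i => Z a i ω) ∂μ ≤ α) := by
  refine ⟨fun _ => ?_, fun Θ Θ' _ _ 𝒜 q f h𝒜 hq hf _ => ?_⟩
  · exact ModelExchange.integral_localBHGlobalFDP_le hZ hexch hindep
      (ModelExchange.ownMixtureInvariant_compositeScore hg_inv)
      (ModelExchange.measurable_evalScores_compositeScore hg_meas) hα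
  · exact ModelExchange.integral_localBHGlobalFDP_le hZ hexch hindep
      (ModelExchange.ownMixtureInvariant_quantizedCompositeScore hg_inv 𝒜 q f)
      (ModelExchange.measurable_evalScores_quantizedCompositeScore hg_meas h𝒜 hq hf) hα
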